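/- **Two-stage sequential elimination contest.** Let $2\le n_2\le n_1$ be integers, let $V_1\ge V_2\ge\dots\ge V_{n_2}\ge 0$ be prizes, and let $g_1,g_2:[0,\infty)\to[0,\infty)$ be strictly increasing, continuous, differentiable cost functions with $g_1(0)=g_2(0)=0$. Each of $n_1$ players privately knows her ability $a_i\in(0,1)$; abilities are i.i.d. with a density $f$ that is continuous on $[0,1]$. In the first stage all players choose efforts $e^1_i\ge 0$, and the players with the $n_2$ highest first-stage efforts are admitted to the second stage; it is publicly announced only who is admitted (the signal $s$, with $s_i=1$ if $i$ is admitted). The admitted players choose efforts $e^2_i\ge0$, and the one with the $\ell$-th highest second-stage effort wins $V_\ell$. Effort $e$ in stage $t$ costs a player of ability $a$ the amount $g_t(e)/a$. **Equilibrium.** A symmetric and monotone Perfect Bayesian equilibrium consists of functions $b^1,b^2$ on $[0,1)$, strictly increasing with $b^1(0)=b^2(0)=0$, and of beliefs $\beta(\cdot\mid s,e)$ (a probability law, for each own first-stage effort $e\ge0$, of the abilities $a_{-i}$ of the other $n_2-1$ admitted players), such that, when all opponents exert efforts $b^1(a_j)$ and $b^2(a_j)$: 1. (Bayesian updating) for every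 first-stage effort $e\ge 0$, on or off the equilibrium path, with which a player advances with positive probability, $\beta(\cdot\mid s,e)$ has the density $$\beta(a_{-i}\mid s,e)=\frac{\prod_{j}f(a_j)\,\Pr(s_{-i}\mid a_{-i},\,s_i=1,\,e)}{\int \Pr(s_{-i}\mid a'_{-i},\,s_i=1,\,e)\prod_{j}f(a'_j)\,da'_{-i}},$$ where $j$ runs over the $n_2-1$ other admitted players and $\Pr(s_{-i}\mid a_{-i},s_i=1,e)$ is the conditional probability that exactly these $n_2-1$ opponents are the other admitted players, given their abilities $a_{-i}$, given that $i$ is admitted, and given $e$ (the abilities of the remaining $n_1-n_2$ players being i.i.d. with density $f$); 2. (sequential rationality) for every ability $a\in(0,1)$ with $f(a)>0$, the effort $b^2(a)$ maximizes over $\tilde e^2\ge0$ the quantity $\sum_{\ell=1}^{n_2}V_\ell P_\ell(\tilde e^2)-g_2(\tilde e^2)/a$, with $P_\ell(\tilde e^2)$ the probability of ranking $\ell$-th in the second stage under the belief $\beta(\cdot\mid s,b^1(a))$; and $b^1(a)$ maximizes over $\tilde e^1\ge0$ the quantity $P(\tilde e^1)\,u^2(\tilde e^1,a)-g_1(\tilde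 e^1)/a$, where $P(\tilde e^1)$ is the prior probability of advancing with effort $\tilde e^1$, and $u^2(\tilde e^1,a)=\sup_{\tilde e^2\ge0}\big(\sum_{\ell}V_\ell P_\ell(\tilde e^2)-g_2(\tilde e^2)/a\big)$ with $P_\ell$ computed under the belief $\beta(\cdot\mid s,\tilde e^1)$. **Proposition.** No two-stage sequential elimination contest, whatever $n_1,n_2$, prizes, density and cost functions as above, has a symmetric and monotone Perfect Bayesian equilibrium. -/

import Mathlib

open MeasureTheory

noncomputable section

/-- A cost-of-effort function on `[0, ∞)`: strictly increasing, continuous, differentiable, and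
zero at zero effort (hence nonnegative). -/
structure IsCostFunction (g : ℝ → ℝ) : Prop where
  strictMonoOn : StrictMonoOn g (Set.Ici 0)
  continuousOn : ContinuousOn g (Set.Ici 0)
  differentiableOn : DifferentiableOn ℝ g (Set.Ici 0)
  zero : g 0 = 0

/-- The data of a two-stage sequential elimination contest: `n₁` players enter the first stage, the
`n₂` highest first-stage efforts enter the second stage. Prizes are ranked: `V ℓ` (with `ℓ` counted
from `0`) is the prize for the `(ℓ + 1)`-st highest second-stage effort. Abilities are i.i.d. on
`(0, 1)` with continuous density `f`; the cost of effort `e` in stage `t` for ability `a` is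
`gₜ e / a`. -/
structure TwoStageContest where
  n₁ : ℕ
  n₂ : ℕ
  two_le_n₂ : 2 ≤ n₂
  n₂_le_n₁ : n₂ ≤ n₁
  V : Fin n₂ → ℝ
  V_antitone : Antitone V
  V_nonneg : ∀ l, 0 ≤ V l
  f : ℝ → ℝ
  f_continuousOn : ContinuousOn f (Set.Icc 0 1)
  f_nonneg : ∀ x ∈ Set.Icc (0 : ℝ) 1, 0 ≤ f x
  f_integral : ∫ x in (0 : ℝ)..1, f x = 1
  g₁ : ℝ → ℝ
  g₁_cost : IsCostFunction g₁
  g₂ : ℝ → ℝ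
  g₂_cost : IsCostFunction g₂

namespace TwoStageContest

variable (C : TwoStageContest)

/-- The law of one player's ability. -/
def prior : Measure ℝ :=
  (volume.restrict (Set.Ioo 0 1)).withDensity (fun x => ENNReal.ofReal (C.f x))

/-- The abilities that occur: those at which the density is positive. -/
def abilities : Set ℝ := {a | a ∈ Set.Ioo 0 1 ∧ 0 < C.f a}

/-- The probability, before the first stage, that a player with first-stage effort `e` advances,
i.e. that fewer than `n₂` of her `n₁ - 1` opponents, who all use `b₁`, exert more effort. (Ties have
probability zero when `b₁` is strictly increasing.) -/
def advanceProb (b₁ : ℝ → ℝ) (e : ℝ) : ℝ :=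
  (Measure.pi (fun _ : Fin (C.n₁ - 1) => C.prior)).real
    {x | (Finset.univ.filter (fun j => e < b₁ (x j))).card < C.n₂}

/-- Fix a player with first-stage effort `e`, and a set of `n₂ - 1` opponents, with abilities `y`.
This is the event, in terms of the abilities `z` of the remaining `n₁ - n₂` players, that the player
herself is admitted. -/
def selfAdmitted (b₁ : ℝ → ℝ) (e : ℝ) (y : Fin (C.n₂ - 1) → ℝ) :
    Set (Fin (C.n₁ - C.n₂) → ℝ) :=
  {z | (Finset.univ.filter (fun j => e < b₁ (y j))).card
      + (Finset.univ.filter (fun k => e < b₁ (z k))).card < C.n₂}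

/-- The event that the admitted players are exactly the player herself and the `n₂ - 1` opponents
with abilities `y`: none of the remaining players exerts more effort than any of them. -/
def signalEvent (b₁ : ℝ → ℝ) (e : ℝ) (y : Fin (C.n₂ - 1) → ℝ) :
    Set (Fin (C.n₁ - C.n₂) → ℝ) :=
  {z | ∀ k, b₁ (z k) ≤ e ∧ ∀ j, b₁ (z k) ≤ b₁ (y j)}

/-- `Pr(s₋ᵢ | a₋ᵢ, sᵢ = 1, eᵢ)`: the conditional probability that exactly the `n₂ - 1` opponents
with abilities `y` are the other admitted players, given that the player herself is admitted, given
her first-stage effort `e`, and given `y`. -/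
def signalProb (b₁ : ℝ → ℝ) (e : ℝ) (y : Fin (C.n₂ - 1) → ℝ) : ENNReal :=
  Measure.pi (fun _ : Fin (C.n₁ - C.n₂) => C.prior) (C.signalEvent b₁ e y ∩ C.selfAdmitted b₁ e y)
    / Measure.pi (fun _ : Fin (C.n₁ - C.n₂) => C.prior) (C.selfAdmitted b₁ e y)

/-- The measure `∏ f(yⱼ) · Pr(s₋ᵢ | y, sᵢ = 1, e) dy` on the abilities of the other admitted
players. -/
def unnormalizedBelief (b₁ : ℝ → ℝ) (e : ℝ) : Measure (Fin (C.n₂ - 1) → ℝ) :=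
  (Measure.pi (fun _ : Fin (C.n₂ - 1) => C.prior)).withDensity (C.signalProb b₁ e)

/-- The updated belief of an admitted player with first-stage effort `e` about the abilities of the
other admitted players, when all opponents use `b₁` in the first stage. -/
def bayesBelief (b₁ : ℝ → ℝ) (e : ℝ) : Measure (Fin (C.n₂ - 1) → ℝ) :=
  (C.unnormalizedBelief b₁ e Set.univ)⁻¹ • C.unnormalizedBelief b₁ e

/-- The probability that second-stage effort `e` wins prize `l` (exactly `l` admitted opponents
exert more), when the admitted opponents use `b₂` and their abilities have law `ν`. -/
def prizeProb (ν : Measure (Fin (C.n₂ - 1) → ℝ)) (b₂ : ℝ → ℝ) (e : ℝ) (l : Fin C.n₂) : ℝ :=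
  ν.real {y | (Finset.univ.filter (fun j => e < b₂ (y j))).card = (l : ℕ)}

/-- The expected second-stage utility of an admitted player with ability `a` and belief `ν` from
effort `e`. -/
def stageTwoPayoff (ν : Measure (Fin (C.n₂ - 1) → ℝ)) (b₂ : ℝ → ℝ) (a e : ℝ) : ℝ :=
  ∑ l : Fin C.n₂, C.V l * C.prizeProb ν b₂ e l - C.g₂ e / a

/-- The optimal expected second-stage utility of an admitted player with ability `a` and belief
`ν`; the set is nonempty, and bounded above by the first prize. -/
def stageTwoValue (ν : Measure (Fin (C.n₂ - 1) → ℝ)) (b₂ : ℝ → ℝ) (a : ℝ) : ℝ :=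
  sSup (C.stageTwoPayoff ν b₂ a '' Set.Ici 0)

/-- The expected utility, at the start of the first stage, of a player with ability `a` from
first-stage effort `e`; her second-stage belief `β e` depends on her own effort. -/
def stageOnePayoff (b₁ b₂ : ℝ → ℝ) (β : ℝ → Measure (Fin (C.n₂ - 1) → ℝ)) (a e : ℝ) : ℝ :=
  C.advanceProb b₁ e * C.stageTwoValue (β e) b₂ a - C.g₁ e / a

/-- A symmetric and monotone perfect Bayesian equilibrium: every player uses `b₁` in the first and
`b₂` in the second stage, and `β e` is the second-stage belief of an admitted player whose own
first-stage effort was `e`. Beliefs follow the updating rule after every effort `e`, on or off the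
path, with which a player can advance. Optimality is required only of the abilities that occur. -/
structure IsSymmetricMonotonePBE (b₁ b₂ : ℝ → ℝ)
    (β : ℝ → Measure (Fin (C.n₂ - 1) → ℝ)) : Prop where
  strictMono₁ : StrictMonoOn b₁ (Set.Ico 0 1)
  zero₁ : b₁ 0 = 0
  strictMono₂ : StrictMonoOn b₂ (Set.Ico 0 1)
  zero₂ : b₂ 0 = 0
  isProbabilityMeasure : ∀ e, 0 ≤ e → IsProbabilityMeasure (β e)
  bayesian : ∀ e, 0 ≤ e → 0 < C.advanceProb b₁ e → β e = C.bayesBelief b₁ e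
  rational₂ : ∀ a ∈ C.abilities,
    IsMaxOn (C.stageTwoPayoff (β (b₁ a)) b₂ a) (Set.Ici 0) (b₂ a)
  rational₁ : ∀ a ∈ C.abilities,
    IsMaxOn (C.stageOnePayoff b₁ b₂ β a) (Set.Ici 0) (b₁ a)

end TwoStageContest

end

noncomputable section

open Set

namespace TwoStageContest

variable (C : TwoStageContest)

/-! The obstruction is in the second stage, among low abilities. Let `F` be the distribution
function of abilities. If all named opponents are stronger than `a`, being admitted at effort `b₁ a`
forces all remaining players to be weaker, so the signal has conditional probability one
(`signalProb_eq_one`). If some named opponent is weaker, that probability is at most `F a`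
(`signalProb_le`). A weak admitted player is therefore almost sure to face only stronger opponents.

Take `a < a'` with `F a'` tiny. Raising effort from `b₂ a` to `b₂ a'` matters to `a'` only if some
opponent is at most `a'`, which `a'` believes very unlikely. It matters to `a` also when all
opponents exceed `a` and some lie in `(a, a']`, an event to which the belief of `a` gives at least
its prior probability. With `X` the prior expected excess of the prize at effort `b₂ a'` over the
last prize, incentive compatibility of `a` and `a'` bounds the cost increase below by `a *
(1/4)^(n₂-1) * X` and above by `a' * q * X`, with `q` of order `F a'`. For `a' ≤ 4 * a` and `q`
small these bounds conflict. Such pairs come from `exists_abilities_pair`. The case `n₁ = n₂` is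
separate: first-stage effort then buys nothing. -/

/-! ### The prior and its distribution function. -/

theorem f_integrableOn : IntegrableOn C.f (Ioo 0 1) :=
  (C.f_continuousOn.integrableOn_compact isCompact_Icc).mono_set Ioo_subset_Icc_self

instance : IsProbabilityMeasure C.prior := by
  constructor
  rw [prior, withDensity_apply _ MeasurableSet.univ, Measure.restrict_univ,
    ← ofReal_integral_eq_lintegral_ofReal C.f_integrableOn
      ((ae_restrict_iff' measurableSet_Ioo).2 (.of_forall fun x hx =>
        C.f_nonneg x (Ioo_subset_Icc_self hx))),
    ← integral_Ioc_eq_integral_Ioo, ← intervalIntegral.integral_of_le zero_le_one, C.f_integral,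
    ENNReal.ofReal_one]

theorem ae_prior_mem_Ioo : ∀ᵐ x ∂C.prior, x ∈ Ioo (0 : ℝ) 1 :=
  (withDensity_absolutelyContinuous _ _).ae_le (ae_restrict_mem measurableSet_Ioo)

theorem ae_pi_prior_mem_Ioo (ι : Type*) [Fintype ι] :
    ∀ᵐ y ∂Measure.pi (fun _ : ι => C.prior), ∀ i, y i ∈ Ioo (0 : ℝ) 1 :=
  ae_all_iff.2 fun i => (Measure.quasiMeasurePreserving_eval (fun _ : ι => C.prior) i).ae
    C.ae_prior_mem_Ioo

/-- The distribution function of abilities. -/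
def abilityCDF (x : ℝ) : ℝ := C.prior.real (Iic x)

theorem abilityCDF_mono : Monotone C.abilityCDF := fun _ _ h =>
  measureReal_mono (Iic_subset_Iic.2 h)

theorem prior_Ioc {x y : ℝ} (h : x ≤ y) :
    C.prior.real (Ioc x y) = C.abilityCDF y - C.abilityCDF x := by
  rw [abilityCDF, abilityCDF, ← measureReal_sdiff (Iic_subset_Iic.2 h) measurableSet_Iic]
  congr 1
  ext z; simp [and_comm]

theorem prior_Ioi (x : ℝ) : C.prior.real (Ioi x) = 1 - C.abilityCDF x := by
  rw [← compl_Iic, probReal_compl_eq_one_sub measurableSet_Iic, abilityCDF]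

theorem exists_prior_le : ∃ M : NNReal, C.prior ≤ M • volume := by
  obtain ⟨M, hM⟩ := isCompact_Icc.exists_bound_of_continuousOn C.f_continuousOn
  refine ⟨M.toNNReal, ?_⟩
  have h : C.prior ≤ (volume.restrict (Ioo 0 1)).withDensity fun _ => (M.toNNReal : ENNReal) := by
    refine withDensity_mono ((ae_restrict_iff' measurableSet_Ioo).2 (.of_forall fun x hx => ?_))
    exact ENNReal.ofReal_le_ofReal ((le_abs_self _).trans (hM x (Ioo_subset_Icc_self hx)))
  refine h.trans ?_
  rw [withDensity_const]
  intro s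
  simp only [Measure.smul_apply, smul_eq_mul]
  exact mul_le_mul_right (Measure.restrict_le_self s) _

theorem exists_abilityCDF_sub_le :
    ∃ M : ℝ, ∀ x y, x ≤ y → C.abilityCDF y - C.abilityCDF x ≤ M * (y - x) := by
  obtain ⟨M, hM⟩ := C.exists_prior_le
  refine ⟨M, fun x y h => ?_⟩
  rw [← C.prior_Ioc h]
  have hvol : (M • volume) (Ioc x y) = ENNReal.ofReal (M * (y - x)) := by
    rw [Measure.smul_apply, Real.volume_Ioc, ENNReal.smul_def, smul_eq_mul,
      ENNReal.ofReal_mul M.coe_nonneg, ENNReal.ofReal_coe_nnreal]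
  refine (ENNReal.toReal_mono (by rw [hvol]; exact ENNReal.ofReal_ne_top) (hM (Ioc x y))).trans_eq ?_
  rw [hvol, ENNReal.toReal_ofReal (mul_nonneg M.coe_nonneg (sub_nonneg.2 h))]

theorem continuous_abilityCDF : Continuous C.abilityCDF := by
  obtain ⟨M, hM⟩ := C.exists_abilityCDF_sub_le
  refine (LipschitzWith.of_dist_le_mul (K := M.toNNReal) fun x y => ?_).continuous
  wlog h : x ≤ y generalizing x y
  · rw [dist_comm, dist_comm x]; exact this y x (le_of_not_ge h)
  rw [dist_comm, dist_comm x, Real.dist_eq, Real.dist_eq,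
    abs_of_nonneg (sub_nonneg.2 (C.abilityCDF_mono h)), abs_of_nonneg (sub_nonneg.2 h)]
  exact (hM x y h).trans (mul_le_mul_of_nonneg_right (Real.le_coe_toNNReal M) (sub_nonneg.2 h))

theorem abilityCDF_zero : C.abilityCDF 0 = 0 := by
  rw [abilityCDF, measureReal_eq_zero_iff]
  exact measure_mono_null (fun x (hx : x ≤ 0) (h : x ∈ Ioo (0 : ℝ) 1) => not_lt.2 hx h.1)
      (ae_iff.1 C.ae_prior_mem_Ioo)

theorem abilityCDF_one : C.abilityCDF 1 = 1 := by
  have h : C.prior.real (Ioi 1) = 0 := by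
    rw [measureReal_eq_zero_iff]
    exact measure_mono_null (fun x (hx : 1 < x) (h : x ∈ Ioo (0 : ℝ) 1) => lt_asymm hx h.2)
      (ae_iff.1 C.ae_prior_mem_Ioo)
  linarith [C.prior_Ioi 1]

/-- Rationality is demanded only where the density is positive, so test abilities have to be found
there. -/
theorem exists_ability_of_abilityCDF_lt {x y : ℝ} (h : x < y)
    (hF : C.abilityCDF x < C.abilityCDF y) : ∃ c ∈ C.abilities, x < c ∧ c ≤ y := by
  by_contra! hc
  have h0 : C.prior.real (Ioc x y) = 0 := by
    rw [measureReal_eq_zero_iff, prior, withDensity_apply _ measurableSet_Ioc,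
      lintegral_eq_zero_iff' , Filter.EventuallyEq, Measure.restrict_restrict measurableSet_Ioc,
      ae_restrict_iff' (measurableSet_Ioc.inter measurableSet_Ioo)]
    · refine .of_forall fun z hz => ENNReal.ofReal_of_nonpos ?_
      by_contra! hf
      exact (hc z ⟨hz.2, hf⟩ hz.1.1).not_ge hz.1.2
    · exact C.f_integrableOn.aemeasurable.ennreal_ofReal.restrict
  rw [C.prior_Ioc h.le] at h0
  linarith

/-! ### Pairs of low abilities with comparable size but separated quantiles. -/

/-- The distribution function is at most linear near zero because the density is bounded. It cannot
keep more than half its value each time its argument is divided by four. -/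
theorem exists_abilityCDF_quarter_le {ε : ℝ} (hε : 0 < ε) :
    ∃ x, 0 < x ∧ 0 < C.abilityCDF x ∧ C.abilityCDF x < ε ∧
      C.abilityCDF (x / 4) ≤ C.abilityCDF x / 2 := by
  wlog hε1 : ε ≤ 1 generalizing ε
  · obtain ⟨x, h1, h2, h3, h4⟩ := this one_pos le_rfl
    exact ⟨x, h1, h2, h3.trans (not_le.1 hε1), h4⟩
  obtain ⟨d, hd, hFd⟩ := intermediate_value_Icc zero_le_one C.continuous_abilityCDF.continuousOn
    (show ε / 2 ∈ Icc (C.abilityCDF 0) (C.abilityCDF 1) by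
      rw [C.abilityCDF_zero, C.abilityCDF_one]; constructor <;> linarith)
  have hd0 : 0 < d := hd.1.lt_of_ne fun h => by
    rw [← h, C.abilityCDF_zero] at hFd; linarith
  by_contra! hc
  have key : ∀ k : ℕ, ε / 2 / 2 ^ k ≤ C.abilityCDF (d / 4 ^ k) := by
    intro k
    induction k with
    | zero => simp [hFd]
    | succ k ih =>
      have h1 := hc (d / 4 ^ k) (by positivity) (lt_of_lt_of_le (by positivity) ih)
        (lt_of_le_of_lt (C.abilityCDF_mono (div_le_self hd.1 (one_le_pow₀ (by norm_num))))
          (by linarith))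
      rw [pow_succ, pow_succ, ← div_div, ← div_div]
      linarith
  obtain ⟨M, hM⟩ := C.exists_abilityCDF_sub_le
  obtain ⟨k, hk⟩ := pow_unbounded_of_one_lt (M * d / (ε / 2)) (one_lt_two)
  have h1 := hM 0 (d / 4 ^ k) (by positivity)
  rw [C.abilityCDF_zero, sub_zero, sub_zero] at h1
  have h2 := (key k).trans h1
  have h4 : (4 : ℝ) ^ k = 2 ^ k * 2 ^ k := by rw [← mul_pow]; norm_num
  rw [div_lt_iff₀ (by positivity)] at hk
  rw [h4, ← mul_div_assoc, ← div_div, div_le_div_iff_of_pos_right (by positivity),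
    le_div_iff₀ (by positivity)] at h2
  linarith

theorem exists_abilities_pair {ε : ℝ} (hε : 0 < ε) :
    ∃ a ∈ C.abilities, ∃ a' ∈ C.abilities, a < a' ∧ a' ≤ 4 * a ∧ C.abilityCDF a' < ε ∧
      0 < C.abilityCDF a ∧ C.abilityCDF a ≤ 3 / 4 * C.abilityCDF a' := by
  obtain ⟨x, hx, hF, hFε, hq⟩ := C.exists_abilityCDF_quarter_le hε
  have hle : x / 4 ≤ x := by linarith
  -- The levels 11/20 < 3/5 < 4/5 lie above `F (x / 4) ≤ F x / 2`, and 3/5 = 3/4 · 4/5. Choosing `a`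
  -- in `(c₀, c₁]` and `a'` in `(c₂, x]` keeps both in `[x / 4, x]`, whence `a' ≤ 4 * a`.
  obtain ⟨c₀, hc₀, hFc₀⟩ := intermediate_value_Icc hle C.continuous_abilityCDF.continuousOn
    (show 11 / 20 * C.abilityCDF x ∈ Icc (C.abilityCDF (x / 4)) (C.abilityCDF x) by
      constructor <;> linarith)
  obtain ⟨c₁, hc₁, hFc₁⟩ := intermediate_value_Icc hle C.continuous_abilityCDF.continuousOn
    (show 3 / 5 * C.abilityCDF x ∈ Icc (C.abilityCDF (x / 4)) (C.abilityCDF x) by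
      constructor <;> linarith)
  obtain ⟨c₂, hc₂, hFc₂⟩ := intermediate_value_Icc hle C.continuous_abilityCDF.continuousOn
    (show 4 / 5 * C.abilityCDF x ∈ Icc (C.abilityCDF (x / 4)) (C.abilityCDF x) by
      constructor <;> linarith)
  have lt_of {u w : ℝ} (h : C.abilityCDF u < C.abilityCDF w) : u < w :=
    C.abilityCDF_mono.reflect_lt h
  obtain ⟨a, ha, ha1, ha2⟩ := C.exists_ability_of_abilityCDF_lt (lt_of (u := c₀) (w := c₁)
    (by linarith)) (by linarith)
  obtain ⟨a', ha', ha1', ha2'⟩ := C.exists_ability_of_abilityCDF_lt (lt_of (u := c₂) (w := x)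
    (by linarith)) (by linarith)
  have h1 := C.abilityCDF_mono ha1.le
  have h2 := C.abilityCDF_mono ha2
  have h3 := C.abilityCDF_mono ha1'.le
  have h4 := C.abilityCDF_mono ha2'
  refine ⟨a, ha, a', ha', lt_of (by linarith), ?_, by linarith, by linarith, by linarith⟩
  linarith [hc₀.1]

/-! ### Ranks and expected prizes. -/

/-- The number of coordinates of `y` above `x`. -/
def countAbove {n : ℕ} (x : ℝ) (y : Fin n → ℝ) : ℕ :=
  (Finset.univ.filter (fun j => x < y j)).card

theorem measurable_countAbove {n : ℕ} (x : ℝ) : Measurable (countAbove (n := n) x) := by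
  unfold countAbove
  simp only [Finset.card_filter]
  exact Finset.measurable_fun_sum _ fun j _ =>
    Measurable.ite (measurableSet_lt measurable_const (measurable_pi_apply j))
      measurable_const measurable_const

theorem measurableSet_forall_lt {n : ℕ} (x : ℝ) : MeasurableSet {y : Fin n → ℝ | ∀ j, x < y j} := by
  rw [ofPred_forall]
  exact MeasurableSet.iInter fun j => measurableSet_lt measurable_const (measurable_pi_apply j)

theorem countAbove_le {n : ℕ} (x : ℝ) (y : Fin n → ℝ) : countAbove x y ≤ n :=
  (Finset.card_filter_le _ _).trans_eq (Finset.card_fin n)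

theorem countAbove_anti {n : ℕ} {x x' : ℝ} (h : x ≤ x') (y : Fin n → ℝ) :
    countAbove x' y ≤ countAbove x y :=
  Finset.card_le_card (Finset.monotone_filter_right _ fun _ _ hj => h.trans_lt hj)

theorem countAbove_eq_iff {n : ℕ} {x : ℝ} {y : Fin n → ℝ} :
    countAbove x y = n ↔ ∀ j, x < y j := by
  unfold countAbove
  conv_lhs => rhs; rw [← Finset.card_fin n]
  rw [Finset.card_filter_eq_iff]
  simp

theorem card_filter_lt_eq_countAbove {n : ℕ} {b : ℝ → ℝ} (hb : StrictMonoOn b (Ico 0 1)) {x : ℝ}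
    (hx : x ∈ Ico (0 : ℝ) 1) {y : Fin n → ℝ} (hy : ∀ j, y j ∈ Ioo (0 : ℝ) 1) :
    (Finset.univ.filter (fun j => b x < b (y j))).card = countAbove x y := by
  unfold countAbove
  congr 1
  exact Finset.filter_congr fun j _ => hb.lt_iff_lt hx (Ioo_subset_Ico_self (hy j))

/-- The prize as a function of the number of admitted opponents with more effort. -/
def prize (k : ℕ) : ℝ := if h : k < C.n₂ then C.V ⟨k, h⟩ else 0

/-- The default value 0 beyond the last prize preserves monotonicity because prizes are nonnegative.
-/
theorem prize_antitone : Antitone C.prize := by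
  intro k l hkl
  unfold prize
  split_ifs with h1 h2 h2
  · exact C.V_antitone hkl
  · exact absurd (hkl.trans_lt h1) h2
  · exact C.V_nonneg _
  · exact le_rfl

theorem integrable_comp_countAbove {n : ℕ} (v : ℕ → ℝ) (ν : Measure (Fin n → ℝ))
    [IsFiniteMeasure ν] (x : ℝ) : Integrable (fun y => v (countAbove x y)) ν := by
  have hm : Measurable fun y : Fin n → ℝ => v (countAbove x y) :=
    (measurable_of_countable v).comp (measurable_countAbove x)
  refine Integrable.of_bound hm.aestronglyMeasurable (∑ k ∈ Finset.range (n + 1), |v k|)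
    (.of_forall fun y => ?_)
  exact Finset.single_le_sum (f := fun k => |v k|) (fun _ _ => abs_nonneg _)
    (Finset.mem_range_succ_iff.2 (countAbove_le x y))

/-- Strict monotonicity turns comparisons of efforts into comparisons of abilities, almost surely.
-/
theorem sum_mul_prizeProb {b : ℝ → ℝ} (hb : StrictMonoOn b (Ico 0 1)) {x : ℝ}
    (hx : x ∈ Ico (0 : ℝ) 1) (ν : Measure (Fin (C.n₂ - 1) → ℝ)) [IsFiniteMeasure ν]
    (hν : ∀ᵐ y ∂ν, ∀ j, y j ∈ Ioo (0 : ℝ) 1) :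
    ∑ l, C.V l * C.prizeProb ν b (b x) l = ∫ y, C.prize (countAbove x y) ∂ν := by
  have hprob (l : Fin C.n₂) :
      C.prizeProb ν b (b x) l = ν.real (countAbove x ⁻¹' {(l : ℕ)}) := by
    refine measureReal_congr ?_
    filter_upwards [hν] with y hy
    exact congrArg (· = (l : ℕ)) (card_filter_lt_eq_countAbove hb hx hy)
  have hset (l : Fin C.n₂) :
      MeasurableSet (countAbove x ⁻¹' {(l : ℕ)} : Set (Fin (C.n₂ - 1) → ℝ)) :=
    measurable_countAbove x (measurableSet_singleton _)
  have hprize (y : Fin (C.n₂ - 1) → ℝ) : C.prize (countAbove x y) =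
      ∑ l : Fin C.n₂, (countAbove x ⁻¹' {(l : ℕ)}).indicator (fun _ => C.V l) y := by
    have hlt : countAbove x y < C.n₂ := by
      have := countAbove_le x y
      have := C.two_le_n₂
      omega
    rw [Finset.sum_eq_single ⟨countAbove x y, hlt⟩]
    · simp [prize, hlt]
    · intro l _ hl
      refine indicator_of_notMem (fun h => hl (Fin.ext ?_)) _
      exact Eq.symm h
    · simp
  simp_rw [hprize, hprob]
  rw [integral_finsetSum _ fun l _ => (integrable_const _).indicator (hset l)]
  refine Finset.sum_congr rfl fun l _ => ?_
  rw [integral_indicator_const _ (hset l), smul_eq_mul, mul_comm]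

theorem pi_prior_forall_le {ι : Type*} [Fintype ι] (x : ℝ) :
    Measure.pi (fun _ : ι => C.prior) {z | ∀ k, z k ≤ x} = C.prior (Iic x) ^ Fintype.card ι := by
  have h : {z : ι → ℝ | ∀ k, z k ≤ x} = Set.pi univ fun _ => Iic x := by
    ext; simp only [mem_ofPred_eq, mem_univ_pi, mem_Iic]
  rw [h, Measure.pi_pi, Finset.prod_const, Finset.card_univ]

theorem pi_prior_forall_gt {ι : Type*} [Fintype ι] (x : ℝ) :
    Measure.pi (fun _ : ι => C.prior) {z | ∀ k, x < z k} = C.prior (Ioi x) ^ Fintype.card ι := by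
  have h : {z : ι → ℝ | ∀ k, x < z k} = Set.pi univ fun _ => Ioi x := by ext; simp
  rw [h, Measure.pi_pi, Finset.prod_const, Finset.card_univ]

/-- It suffices that every coordinate except the first be at most `x`. -/
theorem prior_Iic_pow_le {N : ℕ} (hN : N ≠ 0) (x : ℝ) :
    C.prior (Iic x) ^ (N - 1) ≤
      Measure.pi (fun _ : Fin N => C.prior) {z | countAbove x z ≤ 1} := by
  obtain ⟨M, rfl⟩ := Nat.exists_eq_succ_of_ne_zero hN
  have h : Set.pi univ (Fin.cons univ fun _ : Fin M => Iic x) ⊆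
      {z : Fin (M + 1) → ℝ | countAbove x z ≤ 1} := by
    intro z hz
    refine Finset.card_le_one.2 fun i hi j hj => ?_
    have h0 (i : Fin (M + 1)) (hi : i ∈ Finset.univ.filter fun j => x < z j) : i = 0 := by
      by_contra hne
      obtain ⟨k, rfl⟩ := Fin.exists_succ_eq.2 hne
      exact absurd (Finset.mem_filter.1 hi).2 (not_lt.2 (by simpa using hz k.succ (mem_univ _)))
    rw [h0 i hi, h0 j hj]
  refine le_trans (le_of_eq ?_) (measure_mono h)
  rw [Measure.pi_pi, Fin.prod_univ_succ]
  simp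

/-! ### Posterior beliefs compared with the prior. -/

section Belief

variable {C} {b : ℝ → ℝ} {a : ℝ}

theorem advanceProb_pos (hb : StrictMonoOn b (Ico 0 1)) (ha : a ∈ Ico (0 : ℝ) 1)
    (hF : 0 < C.abilityCDF a) : 0 < C.advanceProb b (b a) := by
  have h0 : 0 < (Measure.pi (fun _ : Fin (C.n₁ - 1) => C.prior)).real {z | ∀ k, z k ≤ a} := by
    rw [measureReal_def, pi_prior_forall_le, ENNReal.toReal_pow]
    exact pow_pos hF _
  refine h0.trans_le (ENNReal.toReal_mono (measure_ne_top _ _) (measure_mono_ae ?_))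
  filter_upwards [C.ae_pi_prior_mem_Ioo _] with z hz h
  change (Finset.univ.filter fun j => b a < b (z j)).card < C.n₂
  rw [card_filter_lt_eq_countAbove hb ha hz, countAbove, Finset.filter_false_of_mem]
  · have := C.two_le_n₂
    simp only [Finset.card_empty]; omega
  · exact fun j _ => not_lt.2 (h j)

theorem signalProb_le_one (e : ℝ) (y : Fin (C.n₂ - 1) → ℝ) : C.signalProb b e y ≤ 1 :=
  ENNReal.div_le_of_le_mul (by rw [one_mul]; exact measure_mono inter_subset_right)

/-- Against stronger opponents only, being admitted reveals the whole signal. -/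
theorem signalProb_eq_one (hb : StrictMonoOn b (Ico 0 1)) (ha : a ∈ Ico (0 : ℝ) 1)
    (hF : 0 < C.abilityCDF a) {y : Fin (C.n₂ - 1) → ℝ} (hy : ∀ j, y j ∈ Ioo (0 : ℝ) 1)
    (hay : ∀ j, a < y j) : C.signalProb b (b a) y = 1 := by
  have h2 := C.two_le_n₂
  have hself : (C.selfAdmitted b (b a) y : Set _) =ᵐ[Measure.pi fun _ => C.prior]
      {z | ∀ k, z k ≤ a} := by
    filter_upwards [C.ae_pi_prior_mem_Ioo _] with z hz
    refine propext ?_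
    change _ + _ < C.n₂ ↔ ∀ k, z k ≤ a
    rw [card_filter_lt_eq_countAbove hb ha hy, card_filter_lt_eq_countAbove hb ha hz,
      countAbove_eq_iff.2 hay]
    have h0 : C.n₂ - 1 + countAbove a z < C.n₂ ↔ countAbove a z = 0 := by omega
    rw [h0, countAbove, Finset.card_eq_zero, Finset.filter_eq_empty_iff]
    simp
  have hinter : (C.signalEvent b (b a) y ∩ C.selfAdmitted b (b a) y : Set _)
      =ᵐ[Measure.pi fun _ => C.prior] C.selfAdmitted b (b a) y := by
    filter_upwards [C.ae_pi_prior_mem_Ioo _, hself] with z hz hs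
    refine propext ⟨And.right, fun h => ⟨fun k => ?_, h⟩⟩
    have hk : ∀ k, z k ≤ a := hs.mp h
    have hza := (hb.le_iff_le (Ioo_subset_Ico_self (hz k)) ha).2 (hk k)
    exact ⟨hza, fun j => hza.trans
      ((hb.le_iff_le ha (Ioo_subset_Ico_self (hy j))).2 (hay j).le)⟩
  rw [signalProb, measure_congr hinter, measure_congr hself, pi_prior_forall_le]
  -- Positivity of `F a` rules out the quotient 0 / 0, which would be 0.
  refine ENNReal.div_self (pow_ne_zero _ fun h => hF.ne' ?_) (by finiteness)
  rw [abilityCDF, measureReal_def, h, ENNReal.toReal_zero]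

/-- If some named opponent is weaker, the signal has probability at most the chance that a
rejected player is weaker too. -/
theorem signalProb_le (hn : C.n₂ < C.n₁) (hb : StrictMonoOn b (Ico 0 1)) (ha : a ∈ Ico (0 : ℝ) 1)
    {y : Fin (C.n₂ - 1) → ℝ} (hy : ∀ j, y j ∈ Ioo (0 : ℝ) 1)
    (hay : ¬ ∀ j, a < y j) : C.signalProb b (b a) y ≤ C.prior (Iic a) := by
  have hcount : countAbove a y < C.n₂ - 1 :=
    (countAbove_le a y).lt_of_ne fun h => hay (countAbove_eq_iff.1 h)
  have hN : C.n₁ - C.n₂ ≠ 0 := by omega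
  have hs : Measure.pi (fun _ => C.prior) (C.signalEvent b (b a) y ∩ C.selfAdmitted b (b a) y) ≤
      C.prior (Iic a) ^ (C.n₁ - C.n₂) := by
    refine (measure_mono_ae ?_).trans_eq ((C.pi_prior_forall_le a).trans
      (by rw [Fintype.card_fin]))
    filter_upwards [C.ae_pi_prior_mem_Ioo _] with z hz h k
    exact (hb.le_iff_le (Ioo_subset_Ico_self (hz k)) ha).1 (h.1 k).1
  -- At most `n₂ - 2` named opponents are stronger, so own admission tolerates one stronger player
  -- among the rest. The denominator thus has one factor `F a` fewer than the numerator.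
  have ht : C.prior (Iic a) ^ (C.n₁ - C.n₂ - 1) ≤
      Measure.pi (fun _ => C.prior) (C.selfAdmitted b (b a) y) := by
    refine (C.prior_Iic_pow_le hN a).trans (measure_mono_ae ?_)
    filter_upwards [C.ae_pi_prior_mem_Ioo _] with z hz h
    change _ + _ < C.n₂
    rw [card_filter_lt_eq_countAbove hb ha hy, card_filter_lt_eq_countAbove hb ha hz]
    have h : countAbove a z ≤ 1 := h
    omega
  refine ENNReal.div_le_of_le_mul (hs.trans ?_)
  calc C.prior (Iic a) ^ (C.n₁ - C.n₂)
      = C.prior (Iic a) * C.prior (Iic a) ^ (C.n₁ - C.n₂ - 1) := (mul_pow_sub_one hN _).symm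
    _ ≤ _ := mul_le_mul_right ht _

theorem unnormalizedBelief_le_pi (e : ℝ) :
    C.unnormalizedBelief b e ≤ Measure.pi fun _ => C.prior :=
  (withDensity_mono (.of_forall (signalProb_le_one e))).trans_eq withDensity_one

theorem restrict_pi_le_unnormalizedBelief (hb : StrictMonoOn b (Ico 0 1))
    (ha : a ∈ Ico (0 : ℝ) 1) (hF : 0 < C.abilityCDF a) :
    (Measure.pi fun _ => C.prior).restrict {y | ∀ j, a < y j} ≤
      C.unnormalizedBelief b (b a) := by
  have hA := measurableSet_forall_lt (n := C.n₂ - 1) a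
  refine Measure.le_iff.2 fun s hs => ?_
  rw [Measure.restrict_apply hs, unnormalizedBelief, withDensity_apply _ hs]
  calc Measure.pi (fun _ => C.prior) (s ∩ {y | ∀ j, a < y j})
      = ∫⁻ _ in s ∩ {y | ∀ j, a < y j}, 1 ∂(Measure.pi fun _ => C.prior) := by simp
    _ ≤ ∫⁻ y in s ∩ {y | ∀ j, a < y j}, C.signalProb b (b a) y
          ∂(Measure.pi fun _ => C.prior) := by
        refine lintegral_mono_ae ((ae_restrict_iff' (hs.inter hA)).2 ?_)
        filter_upwards [C.ae_pi_prior_mem_Ioo _] with y hy h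
        exact (signalProb_eq_one hb ha hF hy h.2).ge
    _ ≤ _ := lintegral_mono_set inter_subset_left

theorem unnormalizedBelief_univ_ge (hb : StrictMonoOn b (Ico 0 1))
    (ha : a ∈ Ico (0 : ℝ) 1) (hF : 0 < C.abilityCDF a) :
    C.prior (Ioi a) ^ (C.n₂ - 1) ≤ C.unnormalizedBelief b (b a) univ := by
  have h := restrict_pi_le_unnormalizedBelief hb ha hF univ
  rwa [Measure.restrict_apply MeasurableSet.univ, univ_inter, pi_prior_forall_gt,
    Fintype.card_fin] at h

theorem bayesBelief_absolutelyContinuous (e : ℝ) :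
    C.bayesBelief b e ≪ Measure.pi fun _ => C.prior :=
  (Measure.smul_absolutelyContinuous).trans (unnormalizedBelief_le_pi e).absolutelyContinuous

/-- Normalizing divides by a total mass of at most one, which can only enlarge the measure. -/
theorem restrict_pi_le_bayesBelief (hb : StrictMonoOn b (Ico 0 1))
    (ha : a ∈ Ico (0 : ℝ) 1) (hF : 0 < C.abilityCDF a) :
    (Measure.pi fun _ => C.prior).restrict {y | ∀ j, a < y j} ≤ C.bayesBelief b (b a) := by
  refine (restrict_pi_le_unnormalizedBelief hb ha hF).trans fun s => ?_
  rw [bayesBelief, Measure.smul_apply, smul_eq_mul]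
  refine le_mul_of_one_le_left' (ENNReal.one_le_inv.2 ?_)
  exact (unnormalizedBelief_le_pi _ _).trans prob_le_one

/-- The unnormalized density is at most `F a` on this event, and the normalizing mass is at least
the prior mass of all opponents being stronger. -/
theorem bayesBelief_restrict_le (hn : C.n₂ < C.n₁) (hb : StrictMonoOn b (Ico 0 1))
    (ha : a ∈ Ico (0 : ℝ) 1) (hF : 0 < C.abilityCDF a) :
    (C.bayesBelief b (b a)).restrict {y | ¬ ∀ j, a < y j} ≤
      ((C.prior (Ioi a) ^ (C.n₂ - 1))⁻¹ * C.prior (Iic a)) • Measure.pi fun _ => C.prior := by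
  have hA : MeasurableSet {y : Fin (C.n₂ - 1) → ℝ | ¬ ∀ j, a < y j} :=
    (measurableSet_forall_lt a).compl
  refine Measure.le_iff.2 fun s hs => ?_
  rw [Measure.restrict_apply hs, bayesBelief, Measure.smul_apply, Measure.smul_apply, smul_eq_mul,
    smul_eq_mul, mul_assoc]
  refine mul_le_mul' (ENNReal.inv_le_inv.2 (unnormalizedBelief_univ_ge hb ha hF)) ?_
  rw [unnormalizedBelief, withDensity_apply _ (hs.inter hA)]
  calc ∫⁻ y in s ∩ {y | ¬ ∀ j, a < y j}, C.signalProb b (b a) y ∂(Measure.pi fun _ => C.prior)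
      ≤ ∫⁻ _ in s ∩ {y | ¬ ∀ j, a < y j}, C.prior (Iic a) ∂(Measure.pi fun _ => C.prior) := by
        refine lintegral_mono_ae ((ae_restrict_iff' (hs.inter hA)).2 ?_)
        filter_upwards [C.ae_pi_prior_mem_Ioo _] with y hy h
        exact signalProb_le hn hb ha hy h.2
    _ ≤ _ := by
        rw [setLIntegral_const]
        exact mul_le_mul_right (measure_mono inter_subset_left) _

end Belief

/-! ### Box decomposition of integrals of the rank. -/

theorem setOf_filter_lt_eq {n : ℕ} (x : ℝ) (S : Finset (Fin n)) :
    {y : Fin n → ℝ | Finset.univ.filter (fun j => x < y j) = S} =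
      Set.pi univ fun j => if j ∈ S then Ioi x else Iic x := by
  ext y
  simp only [mem_ofPred_eq, Finset.ext_iff, Finset.mem_filter, Finset.mem_univ, true_and,
    mem_univ_pi]
  refine forall_congr' fun j => ?_
  split_ifs with h <;> simp [h]

theorem integral_comp_countAbove {n : ℕ} (w : ℕ → ℝ) (x : ℝ) (ν : Measure (Fin n → ℝ))
    [IsFiniteMeasure ν] : ∫ y, w (countAbove x y) ∂ν =
      ∑ S : Finset (Fin n), w S.card *
        ν.real (Set.pi univ fun j => if j ∈ S then Ioi x else Iic x) := by
  have hm (S : Finset (Fin n)) :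
      MeasurableSet (Set.pi univ fun j => if j ∈ S then Ioi x else Iic x) :=
    MeasurableSet.univ_pi fun j => by split_ifs <;> measurability
  have hw (y : Fin n → ℝ) : w (countAbove x y) = ∑ S : Finset (Fin n),
      (Set.pi univ fun j => if j ∈ S then Ioi x else Iic x).indicator (fun _ => w S.card) y := by
    simp_rw [← setOf_filter_lt_eq]
    rw [Finset.sum_eq_single (Finset.univ.filter fun j => x < y j)]
    · simp [countAbove]
    · intro S _ hS
      refine indicator_of_notMem ?_ _
      exact fun h => hS (Eq.symm h)
    · simp
  simp_rw [hw]
  rw [integral_finsetSum _ fun S _ => (integrable_const _).indicator (hm S)]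
  refine Finset.sum_congr rfl fun S _ => ?_
  rw [integral_indicator_const _ (hm S), smul_eq_mul, mul_comm]

/-- Split into boxes by the set of coordinates above `a'`. Restricting to coordinates above `a`
leaves each side `Ioi a'` intact and shrinks each side `Iic a'` to `Ioc a a'`, which costs at most a
factor `c` per coordinate. -/
theorem pow_mul_integral_comp_countAbove_le (μ : Measure ℝ) [IsProbabilityMeasure μ] {n : ℕ}
    {w : ℕ → ℝ} (hw : ∀ k ≤ n, 0 ≤ w k) {a a' c : ℝ} (haa' : a ≤ a') (hc0 : 0 ≤ c) (hc1 : c ≤ 1)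
    (hc : c * μ.real (Iic a') ≤ μ.real (Ioc a a')) :
    c ^ n * ∫ y, w (countAbove a' y) ∂(Measure.pi fun _ : Fin n => μ) ≤
      ∫ y in {y | ∀ j, a < y j}, w (countAbove a' y) ∂(Measure.pi fun _ : Fin n => μ) := by
  rw [integral_comp_countAbove, integral_comp_countAbove, Finset.mul_sum]
  refine Finset.sum_le_sum fun S _ => ?_
  rw [measureReal_restrict_apply' (measurableSet_forall_lt a), mul_left_comm]
  refine mul_le_mul_of_nonneg_left ?_ (hw _ (card_finset_fin_le S))
  have hinter : (Set.pi univ fun j => if j ∈ S then Ioi a' else Iic a') ∩ {y | ∀ j, a < y j} =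
      Set.pi univ fun j => if j ∈ S then Ioi a' else Ioc a a' := by
    ext y
    simp only [mem_inter_iff, mem_univ_pi, mem_ofPred_eq, ← forall_and]
    refine forall_congr' fun j => ?_
    split_ifs
    · exact ⟨And.left, fun h => ⟨h, haa'.trans_lt h⟩⟩
    · exact and_comm
  rw [hinter, measureReal_def, measureReal_def, Measure.pi_pi, Measure.pi_pi,
    ENNReal.toReal_prod, ENNReal.toReal_prod]
  calc _ = ∏ j, c * (μ (if j ∈ S then Ioi a' else Iic a')).toReal := by
        rw [Finset.prod_mul_distrib, Finset.prod_const, Finset.card_univ, Fintype.card_fin]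
    _ ≤ _ := by
        refine Finset.prod_le_prod (fun j _ => mul_nonneg hc0 ENNReal.toReal_nonneg) fun j _ => ?_
        split_ifs
        · exact mul_le_of_le_one_left ENNReal.toReal_nonneg hc1
        · exact hc

/-! ### Incentive constraints and the contradiction. -/

variable {C} {b₁ b₂ : ℝ → ℝ} {β : ℝ → Measure (Fin (C.n₂ - 1) → ℝ)}

namespace IsSymmetricMonotonePBE

theorem belief_eq (h : C.IsSymmetricMonotonePBE b₁ b₂ β) {a : ℝ} (ha : a ∈ Ico (0 : ℝ) 1)
    (hF : 0 < C.abilityCDF a) : β (b₁ a) = C.bayesBelief b₁ (b₁ a) := by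
  refine h.bayesian _ ?_ (advanceProb_pos h.strictMono₁ ha hF)
  rw [← h.zero₁]
  exact h.strictMono₁.monotoneOn ⟨le_rfl, one_pos⟩ ha ha.1

/-- An ability that occurs does not gain by imitating the second-stage effort of another. -/
theorem integral_prize_sub_le (h : C.IsSymmetricMonotonePBE b₁ b₂ β) {a x : ℝ}
    (ha : a ∈ C.abilities) (hF : 0 < C.abilityCDF a) (hx : x ∈ Ico (0 : ℝ) 1) :
    a * ((∫ y, C.prize (countAbove x y) ∂C.bayesBelief b₁ (b₁ a)) -
      ∫ y, C.prize (countAbove a y) ∂C.bayesBelief b₁ (b₁ a)) ≤ C.g₂ (b₂ x) - C.g₂ (b₂ a) := by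
  have ha' := Ioo_subset_Ico_self ha.1
  have hpos (u : ℝ) (hu : u ∈ Ico (0 : ℝ) 1) : 0 ≤ b₂ u := by
    rw [← h.zero₂]; exact h.strictMono₂.monotoneOn ⟨le_rfl, one_pos⟩ hu hu.1
  have hb : 0 ≤ b₁ a := by
    rw [← h.zero₁]; exact h.strictMono₁.monotoneOn ⟨le_rfl, one_pos⟩ ha' ha'.1
  have hβ := h.belief_eq ha' hF
  have hprob := h.isProbabilityMeasure _ hb
  have hopt := h.rational₂ a ha (hpos x hx)
  rw [hβ] at hopt hprob
  have hν : ∀ᵐ y ∂C.bayesBelief b₁ (b₁ a), ∀ j, y j ∈ Ioo (0 : ℝ) 1 :=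
    (bayesBelief_absolutelyContinuous _).ae_le (C.ae_pi_prior_mem_Ioo _)
  simp only [stageTwoPayoff, mem_ofPred_eq, C.sum_mul_prizeProb h.strictMono₂ hx _ hν,
    C.sum_mul_prizeProb h.strictMono₂ ha' _ hν] at hopt
  have ha0 := ha.1.1
  have : (∫ y, C.prize (countAbove x y) ∂C.bayesBelief b₁ (b₁ a)) -
      ∫ y, C.prize (countAbove a y) ∂C.bayesBelief b₁ (b₁ a) ≤
      (C.g₂ (b₂ x) - C.g₂ (b₂ a)) / a := by rw [sub_div]; linarith
  rwa [le_div_iff₀ ha0, mul_comm] at this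

/-- If nobody is eliminated, first-stage effort is wasted. -/
theorem n₂_lt_n₁ (h : C.IsSymmetricMonotonePBE b₁ b₂ β) : C.n₂ < C.n₁ := by
  refine C.n₂_le_n₁.lt_of_ne fun hn => ?_
  have h2 := C.two_le_n₂
  have hadv (e : ℝ) : C.advanceProb b₁ e = 1 := by
    refine (congrArg _ (eq_univ_of_forall fun x => ?_)).trans probReal_univ
    exact (Finset.card_filter_le _ _).trans_lt (by rw [Finset.card_fin]; omega)
  have hempty : IsEmpty (Fin (C.n₁ - C.n₂)) := by
    rw [hn, Nat.sub_self]; infer_instance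
  have hsig (e : ℝ) : C.signalProb b₁ e = 1 := by
    funext y
    have hself : C.selfAdmitted b₁ e y = univ := eq_univ_of_forall fun z => by
      have := Finset.card_filter_le (Finset.univ : Finset (Fin (C.n₂ - 1)))
        fun j => e < b₁ (y j)
      rw [Finset.card_fin] at this
      change _ + _ < C.n₂
      rw [Finset.univ_eq_empty (α := Fin (C.n₁ - C.n₂)), Finset.filter_empty, Finset.card_empty]
      omega
    have hevent : C.signalEvent b₁ e y = univ := eq_univ_of_forall fun z k => hempty.elim k
    simp [signalProb, hself, hevent]
  obtain ⟨a, ha, -, -, -, -, -, hF, -⟩ := C.exists_abilities_pair one_pos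
  have ha' := Ioo_subset_Ico_self ha.1
  have hb : 0 < b₁ a := by
    have := h.strictMono₁ ⟨le_rfl, one_pos⟩ ha' ha.1.1
    rwa [h.zero₁] at this
  -- Admission is certain and the signal uninformative, so zero effort yields the same continuation
  -- at a strictly lower cost.
  have hβ : β (b₁ a) = β 0 := by
    rw [h.bayesian _ hb.le (by rw [hadv]; exact one_pos),
      h.bayesian _ le_rfl (by rw [hadv]; exact one_pos)]
    simp only [bayesBelief, unnormalizedBelief, hsig]
  have hopt := h.rational₁ a ha (mem_Ici.2 le_rfl)
  simp only [stageOnePayoff, mem_ofPred_eq, hadv, hβ, C.g₁_cost.zero] at hopt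
  have hg := C.g₁_cost.strictMonoOn (mem_Ici.2 le_rfl) (mem_Ici.2 hb.le) hb
  rw [C.g₁_cost.zero] at hg
  have := div_pos hg ha.1.1
  rw [zero_div] at hopt
  linarith

end IsSymmetricMonotonePBE

/-- A lower bound for the gain, under the belief of ability `a`, from the effort of ability `a'`. -/
theorem le_integral_prize_sub {a a' : ℝ} (hb : StrictMonoOn b₁ (Ico 0 1)) (haa' : a ≤ a')
    (ha : a ∈ Ico (0 : ℝ) 1) (hF : 0 < C.abilityCDF a)
    [IsFiniteMeasure (C.bayesBelief b₁ (b₁ a))] :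
    ∫ y in {y | ∀ j, a < y j}, (C.prize (countAbove a' y) - C.prize (C.n₂ - 1))
        ∂(Measure.pi fun _ : Fin (C.n₂ - 1) => C.prior) ≤
      (∫ y, C.prize (countAbove a' y) ∂C.bayesBelief b₁ (b₁ a)) -
        ∫ y, C.prize (countAbove a y) ∂C.bayesBelief b₁ (b₁ a) := by
  rw [← integral_sub (integrable_comp_countAbove _ _ _) (integrable_comp_countAbove _ _ _)]
  -- Where all opponents exceed `a`, effort `b₂ a` earns the last prize. Elsewhere the gain is still
  -- nonnegative.
  calc ∫ y in {y | ∀ j, a < y j}, (C.prize (countAbove a' y) - C.prize (C.n₂ - 1))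
        ∂(Measure.pi fun _ : Fin (C.n₂ - 1) => C.prior)
      = ∫ y in {y | ∀ j, a < y j}, (C.prize (countAbove a' y) - C.prize (countAbove a y))
        ∂(Measure.pi fun _ : Fin (C.n₂ - 1) => C.prior) :=
        setIntegral_congr_fun (measurableSet_forall_lt a) fun y hy => by
          simp only [countAbove_eq_iff.2 hy]
    _ ≤ _ := integral_mono_measure (restrict_pi_le_bayesBelief hb ha hF)
        (.of_forall fun y => sub_nonneg.2 (C.prize_antitone (countAbove_anti haa' y)))
        ((integrable_comp_countAbove _ _ _).sub (integrable_comp_countAbove _ _ _))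

/-- An upper bound for the loss, under the belief of ability `a'`, from the effort of ability
`a`. -/
theorem integral_prize_sub_le' {a a' : ℝ} (hn : C.n₂ < C.n₁) (hb : StrictMonoOn b₁ (Ico 0 1))
    (haa' : a ≤ a') (ha' : a' ∈ Ico (0 : ℝ) 1) (hF : 0 < C.abilityCDF a')
    (hF1 : C.abilityCDF a' < 1) [IsFiniteMeasure (C.bayesBelief b₁ (b₁ a'))] :
    (∫ y, C.prize (countAbove a' y) ∂C.bayesBelief b₁ (b₁ a')) -
        ∫ y, C.prize (countAbove a y) ∂C.bayesBelief b₁ (b₁ a') ≤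
      C.abilityCDF a' / (1 - C.abilityCDF a') ^ (C.n₂ - 1) *
        ∫ y, (C.prize (countAbove a' y) - C.prize (C.n₂ - 1))
          ∂(Measure.pi fun _ : Fin (C.n₂ - 1) => C.prior) := by
  have hpow : C.prior (Ioi a') ^ (C.n₂ - 1) ≠ 0 := pow_ne_zero _ fun h => by
    have := C.prior_Ioi a'
    rw [measureReal_def, h, ENNReal.toReal_zero] at this
    linarith
  have hcoef : ((C.prior (Ioi a') ^ (C.n₂ - 1))⁻¹ * C.prior (Iic a')).toReal =
      C.abilityCDF a' / (1 - C.abilityCDF a') ^ (C.n₂ - 1) := by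
    rw [← C.prior_Ioi, abilityCDF, ENNReal.toReal_mul, ENNReal.toReal_inv, ENNReal.toReal_pow,
      measureReal_def, measureReal_def, div_eq_inv_mul]
  have hint : ∀ ν : Measure (Fin (C.n₂ - 1) → ℝ), IsFiniteMeasure ν → Integrable
      (fun y => C.prize (countAbove a' y) - C.prize (countAbove a y)) ν := fun ν _ =>
    (integrable_comp_countAbove _ _ _).sub (integrable_comp_countAbove _ _ _)
  have hk : (C.prior (Ioi a') ^ (C.n₂ - 1))⁻¹ * C.prior (Iic a') ≠ ⊤ :=
    ENNReal.mul_ne_top (ENNReal.inv_ne_top.2 hpow) (measure_ne_top _ _)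
  -- If every opponent exceeds `a'`, both efforts earn the last prize, so only the complementary
  -- event contributes.
  rw [← integral_sub (integrable_comp_countAbove _ _ _) (integrable_comp_countAbove _ _ _),
    ← setIntegral_eq_integral_of_forall_compl_eq_zero (s := {y | ¬ ∀ j, a' < y j})]
  · refine (integral_mono_measure (bayesBelief_restrict_le hn hb ha' hF)
      (.of_forall fun y => sub_nonneg.2 (C.prize_antitone (countAbove_anti haa' y)))
      ((hint _ inferInstance).smul_measure hk)).trans ?_
    rw [integral_smul_measure, hcoef, smul_eq_mul]
    refine mul_le_mul_of_nonneg_left (integral_mono (hint _ inferInstance)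
      ((integrable_comp_countAbove _ _ _).sub (integrable_const _)) fun y => ?_) ?_
    · exact sub_le_sub_left (C.prize_antitone (countAbove_le a y)) _
    · exact div_nonneg hF.le (pow_nonneg (by linarith) _)
  · intro y hy
    have hy : ∀ j, a' < y j := not_not.1 hy
    rw [countAbove_eq_iff.2 hy, countAbove_eq_iff.2 fun j => haa'.trans_lt (hy j), sub_self]

theorem not_isSymmetricMonotonePBE : ¬ C.IsSymmetricMonotonePBE b₁ b₂ β := by
  intro h
  have hn := h.n₂_lt_n₁
  -- Since `1 - F a' ≥ 1/2`, this bound on `F a'` gives `4 * q < (1/8)^(n₂-1) * 2^(n₂-1) =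
  -- (1/4)^(n₂-1)`.
  obtain ⟨a, ha, a', ha', haa', ha4, hFε, hF, hF34⟩ :=
    C.exists_abilities_pair (ε := (1 / 8) ^ (C.n₂ - 1) / 4) (by positivity)
  have hε : (1 / 8 : ℝ) ^ (C.n₂ - 1) ≤ 1 := pow_le_one₀ (by norm_num) (by norm_num)
  have hF' : 0 < C.abilityCDF a' := hF.trans_le (C.abilityCDF_mono haa'.le)
  have haI := Ioo_subset_Ico_self ha.1
  have haI' := Ioo_subset_Ico_self ha'.1
  have hfin (u : ℝ) (hu : u ∈ Ico (0 : ℝ) 1) (hFu : 0 < C.abilityCDF u) :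
      IsFiniteMeasure (C.bayesBelief b₁ (b₁ u)) := by
    have hbu : 0 ≤ b₁ u := by
      rw [← h.zero₁]; exact h.strictMono₁.monotoneOn ⟨le_rfl, one_pos⟩ hu hu.1
    have := h.isProbabilityMeasure _ hbu
    rw [h.belief_eq hu hFu] at this
    infer_instance
  have := hfin a haI hF
  have := hfin a' haI' hF'
  have hg : C.g₂ (b₂ a) < C.g₂ (b₂ a') := by
    have h0 := h.strictMono₂.monotoneOn ⟨le_rfl, one_pos⟩ haI haI.1
    have h1 := h.strictMono₂ haI haI' haa'
    rw [h.zero₂] at h0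
    exact C.g₂_cost.strictMonoOn h0 (h0.trans h1.le) h1
  have hIC := h.integral_prize_sub_le ha hF haI'
  have hIC' := h.integral_prize_sub_le ha' hF' haI
  have hlow := le_integral_prize_sub h.strictMono₁ haa'.le haI hF
  have hup := integral_prize_sub_le' hn h.strictMono₁ haa'.le haI' hF' (by linarith)
  -- The constant `c = 1/4` comes from `F a ≤ 3/4 * F a'`.
  have hcmp := pow_mul_integral_comp_countAbove_le C.prior (n := C.n₂ - 1)
    (w := fun k => C.prize k - C.prize (C.n₂ - 1)) (c := 1 / 4)
    (fun k hk => sub_nonneg.2 (C.prize_antitone hk)) haa'.le (by norm_num) (by norm_num)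
    (by rw [C.prior_Ioc haa'.le]; change 1 / 4 * C.abilityCDF a' ≤ _; linarith)
  set X := ∫ y, (C.prize (countAbove a' y) - C.prize (C.n₂ - 1))
    ∂(Measure.pi fun _ : Fin (C.n₂ - 1) => C.prior)
  set q := C.abilityCDF a' / (1 - C.abilityCDF a') ^ (C.n₂ - 1) with hq_def
  have ha0 : 0 < a := ha.1.1
  have ha0' : 0 < a' := ha'.1.1
  have hq0 : 0 < q := div_pos hF' (pow_pos (by linarith) _)
  have hq : 4 * q < (1 / 4) ^ (C.n₂ - 1) := by
    have h1 : (1 / 2 : ℝ) ^ (C.n₂ - 1) ≤ (1 - C.abilityCDF a') ^ (C.n₂ - 1) :=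
      pow_le_pow_left₀ (by norm_num) (by linarith) _
    rw [hq_def, ← mul_div_assoc, div_lt_iff₀ (pow_pos (by linarith) _)]
    calc 4 * C.abilityCDF a' < (1 / 8) ^ (C.n₂ - 1) := by linarith
      _ = (1 / 4) ^ (C.n₂ - 1) * (1 / 2) ^ (C.n₂ - 1) := by rw [← mul_pow]; norm_num
      _ ≤ _ := mul_le_mul_of_nonneg_left h1 (by positivity)
  have h1 : a * ((1 / 4) ^ (C.n₂ - 1) * X) ≤ C.g₂ (b₂ a') - C.g₂ (b₂ a) :=
    (mul_le_mul_of_nonneg_left (hcmp.trans hlow) ha0.le).trans hIC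
  have h2 : C.g₂ (b₂ a') - C.g₂ (b₂ a) ≤ a' * (q * X) := by
    have := mul_le_mul_of_nonneg_left hup ha0'.le
    rw [mul_sub] at this hIC'
    linarith
  -- The strict cost increase forces a positive prize gain; in particular, equal prizes are excluded
  -- here.
  have hX : 0 < X := by
    have : 0 < a' * (q * X) := by linarith
    exact pos_of_mul_pos_right (pos_of_mul_pos_right this ha0'.le) hq0.le
  have h3 : a' * (q * X) ≤ 4 * a * (q * X) := mul_le_mul_of_nonneg_right ha4 (by positivity)
  have h4 : a * (4 * q * X) < a * ((1 / 4) ^ (C.n₂ - 1) * X) :=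
    mul_lt_mul_of_pos_left (mul_lt_mul_of_pos_right hq hX) ha0
  linarith

end TwoStageContest

end

theorem mainTheorem8 (C : TwoStageContest) :
    ¬ ∃ (b₁ b₂ : ℝ → ℝ) (β : ℝ → MeasureTheory.Measure (Fin (C.n₂ - 1) → ℝ)),
      C.IsSymmetricMonotonePBE b₁ b₂ β := by
  rintro ⟨b₁, b₂, β, h⟩
  exact TwoStageContest.not_isSymmetricMonotonePBE h
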